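/- Fix a countably infinite set $U$ (the universe). A database schema $\tau$ is a finite nonempty set of relation symbols $R$ with arities $\mathrm{ar}(R)\in\mathbb N$; a $\tau$-fact is an expression $R(u_1,\dots,u_{\mathrm{ar}(R)})$ with $R\in\tau$ and $u_i\in U$; a $\tau$-instance $D$ is a finite set of $\tau$-facts, and $|D|$ is the number of its facts. A probabilistic database (PDB) over $\tau$ is a pair $(\mathbb D,P)$ of a nonempty countable set $\mathbb D$ of $\tau$-instances and a probability distribution $P$ on $\mathbb D$. A PDB is tuple-independent if for all pairwise distinct facts $f_1,\dots,f_k$ that appear in its instances of positive probability, $\Pr(f_1\in I,\dots,f_k\in I)=\prod_{i=1}^k\Pr(f_i\in I)$. A first-order view from a schema $\sigma$ to $\tau$ consists, for each $R\in\tau$, of a first-order formula $\Phi_R(x_1,\dots,x_{\mathrm{ar}(R)})$ over $\sigma$ (with equality and constants from $U$) whose free variables are exactly the pairwise distinct variables $x_1,\dots,x_{\mathrm{ar}(R)}$. It maps a $\sigma$-instance $I$ to the $\tau$-instance of all facts $R(\bar a)$ with $R \in \tau$, $\bar a\in \mathrm{adom}(I,\Phi_R)^{\mathrm{ar}(R)}$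 and $I\models\Phi_R(\bar a)$, where $\mathrm{adom}(I,\Phi_R)$ is the set of elements of $U$ that occur in $I$ or as constants in $\Phi_R$, and quantifiers range over $\mathrm{adom}(I,\Phi_R)$ (active domain semantics). The image of a PDB $(\mathbb I,Q)$ under a view $\Phi$ is any PDB $(\mathbb D,P)$ with $\Phi(\mathbb I)\subseteq\mathbb D$ and $P(\{D\})=Q(\{I\in\mathbb I:\Phi(I)=D\})$ for all $D\in\mathbb D$. Let $\mathsf{FO}(\mathsf{TI})$ be the class of all PDBs that are images of tuple-independent PDBs (over any schema, and over $U$) under first-order views. **Theorem.** Let $(\mathbb D,P)$ be a PDB. If there is a constant $c\in\mathbb N$, $c\ge 1$, such that $$\sum_{D\in\mathbb D\setminus\{\emptyset\}} |D|\cdot P(\{D\})^{c/|D|}<\infty,$$ then $(\mathbb D,P)\in\mathsf{FO}(\mathsf{TI})$. -/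

import Mathlib

open scoped ENNReal

namespace ProbDB

universe u v

/-- A database schema: a finite, nonempty set of relation symbols with arities. -/
structure Schema where
  Rel : Type v
  [fintypeRel : Fintype Rel]
  [nonemptyRel : Nonempty Rel]
  arity : Rel → ℕ

attribute [instance] Schema.fintypeRel Schema.nonemptyRel

/-- A fact `R(u₁, …, u_{ar(R)})` over the schema `τ` and the universe `U`. -/
abbrev Fact (τ : Schema.{v}) (U : Type u) : Type (max u v) :=
  Σ R : τ.Rel, (Fin (τ.arity R) → U)

/-- A database instance: a finite set of facts. -/
abbrev Instance (τ : Schema.{v}) (U : Type u) : Type (max u v) :=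
  Finset (Fact τ U)

open Classical in
/-- The active domain of an instance: all elements of `U` appearing in its facts. -/
noncomputable def adom {τ : Schema.{v}} {U : Type u} (D : Instance τ U) : Finset U :=
  D.biUnion fun f => Finset.univ.image f.2

/-! ### First-order logic with active domain semantics -/

/-- A term is a variable (variables are named by natural numbers) or a constant from `U`. -/
inductive Term (U : Type u) : Type u
  | var (x : ℕ) : Term U
  | const (a : U) : Term U

namespace Term

variable {U : Type u}

/-- The variables of a term. -/
def vars : Term U → Set ℕ
  | var x => {x}
  | const _ => ∅

/-- The constants of a term. -/
def consts : Term U → Finset U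
  | var _ => ∅
  | const a => {a}

/-- The value of a term under a valuation of the variables. -/
def val (s : ℕ → U) : Term U → U
  | var x => s x
  | const a => a

end Term

/-- First-order formulas over the schema `τ` with constants from `U`. -/
inductive Formula (τ : Schema.{v}) (U : Type u) : Type (max u v)
  | rel (R : τ.Rel) (t : Fin (τ.arity R) → Term U) : Formula τ U
  | eq (x : ℕ) (t : Term U) : Formula τ U
  | not (φ : Formula τ U) : Formula τ U
  | and (φ ψ : Formula τ U) : Formula τ U
  | or (φ ψ : Formula τ U) : Formula τ U
  | imp (φ ψ : Formula τ U) : Formula τ U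
  | ex (x : ℕ) (φ : Formula τ U) : Formula τ U
  | all (x : ℕ) (φ : Formula τ U) : Formula τ U

namespace Formula

variable {τ : Schema.{v}} {U : Type u}

/-- The free variables of a formula. -/
def free : Formula τ U → Set ℕ
  | rel _ t => ⋃ i, (t i).vars
  | eq x t => {x} ∪ t.vars
  | not φ => φ.free
  | and φ ψ => φ.free ∪ ψ.free
  | or φ ψ => φ.free ∪ ψ.free
  | imp φ ψ => φ.free ∪ ψ.free
  | ex x φ => φ.free \ {x}
  | all x φ => φ.free \ {x}

open Classical in
/-- The set of constants appearing in a formula. -/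
noncomputable def consts : Formula τ U → Finset U
  | rel _ t => Finset.univ.biUnion fun i => (t i).consts
  | eq _ t => t.consts
  | not φ => φ.consts
  | and φ ψ => φ.consts ∪ ψ.consts
  | or φ ψ => φ.consts ∪ ψ.consts
  | imp φ ψ => φ.consts ∪ ψ.consts
  | ex _ φ => φ.consts
  | all _ φ => φ.consts

/-- Satisfaction of a formula in the instance `D` under the valuation `s`, where the quantifiers
range over the set `A`. -/
def Sat (A : Finset U) (D : Instance τ U) : Formula τ U → (ℕ → U) → Prop
  | rel R t, s => (⟨R, fun i => (t i).val s⟩ : Fact τ U) ∈ D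
  | eq x t, s => s x = t.val s
  | not φ, s => ¬ φ.Sat A D s
  | and φ ψ, s => φ.Sat A D s ∧ ψ.Sat A D s
  | or φ ψ, s => φ.Sat A D s ∨ ψ.Sat A D s
  | imp φ ψ, s => φ.Sat A D s → ψ.Sat A D s
  | ex x φ, s => ∃ a ∈ A, φ.Sat A D (Function.update s x a)
  | all x φ, s => ∀ a ∈ A, φ.Sat A D (Function.update s x a)

open Classical in
/-- The set `adom(D, φ) = adom(D) ∪ adom(φ)` over which quantifiers and valuations range in the
active domain semantics. -/
noncomputable def activeDomain (φ : Formula τ U) (D : Instance τ U) : Finset U :=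
  adom D ∪ φ.consts

end Formula

/-- An `n`-ary first-order query `Φ(x₁, …, xₙ)`: a formula together with an enumeration of
exactly its free variables by pairwise distinct variables. -/
structure Query (τ : Schema.{v}) (U : Type u) (n : ℕ) where
  formula : Formula τ U
  vars : Fin n → ℕ
  vars_injective : Function.Injective vars
  range_vars : Set.range vars = formula.free

namespace Query

variable {τ : Schema.{v}} {U : Type u} {n : ℕ}

open Classical in
/-- The answer of the query on `D`: all tuples `a` over `adom(D, Φ)` such that `D` satisfies `Φ`
with `a` assigned to the free variables. (The values of `s` at other variables are irrelevant.) -/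
noncomputable def answer (Φ : Query τ U n) (D : Instance τ U) : Finset (Fin n → U) :=
  (Fintype.piFinset fun _ => Φ.formula.activeDomain D).filter fun a =>
    ∃ s : ℕ → U, (∀ i, s (Φ.vars i) = a i) ∧
      Φ.formula.Sat (Φ.formula.activeDomain D) D s

end Query

/-- A first-order view from `τ` to `τ'`: one first-order query over `τ` for each relation symbol
of `τ'`, of the matching arity. -/
def FOView (τ τ' : Schema.{v}) (U : Type u) : Type (max u v) :=
  (R : τ'.Rel) → Query τ U (τ'.arity R)

/-- The output instance of a first-order view: the facts `R(a)` with `a` in the answer of the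
query for `R`. -/
noncomputable def FOView.apply {τ τ' : Schema.{v}} {U : Type u} (Φ : FOView τ τ' U)
    (D : Instance τ U) : Instance τ' U :=
  Finset.univ.sigma fun R => (Φ R).answer D

/-! ### Probabilistic databases -/

/-- A probabilistic database: a discrete probability space whose sample space is a countable
(and, as it carries a probability distribution, nonempty) set of database instances. -/
structure PDB (τ : Schema.{v}) (U : Type u) where
  space : Set (Instance τ U)
  countable_space : space.Countable
  law : PMF space

namespace PDB

variable {τ τ' : Schema.{v}} {U : Type u}

/-- `Pr_{D ∼ 𝒟}(p D)`. -/
noncomputable def prob (𝒟 : PDB τ U) (p : Instance τ U → Prop) : ℝ≥0∞ :=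
  𝒟.law.toOuterMeasure {D | p D}

/-- The set of all facts appearing in instances of positive probability. -/
def facts (𝒟 : PDB τ U) : Set (Fact τ U) :=
  {f | ∃ D : 𝒟.space, 𝒟.law D ≠ 0 ∧ f ∈ (D : Instance τ U)}

/-- Tuple-independence: for pairwise distinct facts `f₁, …, f_k` of the PDB,
`Pr(f₁ ∈ I, …, f_k ∈ I) = Pr(f₁ ∈ I) ⋯ Pr(f_k ∈ I)`. -/
def IsTI (𝓘 : PDB τ U) : Prop :=
  ∀ S : Finset (Fact τ U), (∀ f ∈ S, f ∈ 𝓘.facts) →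
    𝓘.prob (fun I => ∀ f ∈ S, f ∈ I) = ∏ f ∈ S, 𝓘.prob (fun I => f ∈ I)

/-- `𝒟 = V(𝒞)`: the function `V` maps the sample space of `𝒞` to that of `𝒟`, and the
distribution of `𝒟` is the image of that of `𝒞` under `V`. -/
def IsImage (V : Instance τ U → Instance τ' U) (𝒞 : PDB τ U) (𝒟 : PDB τ' U) : Prop :=
  (∀ C ∈ 𝒞.space, V C ∈ 𝒟.space) ∧
    ∀ D : 𝒟.space, 𝒟.law D = 𝒞.prob (fun C => V C = D)

/-- The class `FO(TI)` of all images of tuple-independent PDBs under first-order views. -/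
def InFOTI (𝒟 : PDB τ U) : Prop :=
  ∃ (σ : Schema.{v}) (𝓘 : PDB σ U) (Φ : FOView σ τ U), 𝓘.IsTI ∧ IsImage Φ.apply 𝓘 𝒟

end PDB

end ProbDB

namespace ProbDB

universe u v w

/-! ### Weights of finite sets -/

section Weights

variable {ι : Type*}

/-- The sum of `g` over all finite sets, where the set `S` has weight `∏ f ∈ S, y f`. -/
noncomputable def mass (y : ι → ℝ≥0∞) (g : Finset ι → ℝ≥0∞) : ℝ≥0∞ :=
  ∑' S : Finset ι, (∏ f ∈ S, y f) * g S

theorem tsum_finset_split [DecidableEq ι] (F : Finset ι → ℝ≥0∞) (f : ι) :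
    ∑' S, F S = ∑' S, if f ∈ S then 0 else F S + F (insert f S) := by
  have hinv : Function.Involutive (fun S : Finset ι => symmDiff S {f}) := fun S => by
    simp
  have h1 : ∑' S, (if f ∈ S then F S else 0) = ∑' S, if f ∈ S then 0 else F (insert f S) := by
    rw [← hinv.toPerm.tsum_eq]
    refine tsum_congr fun S => ?_
    change (if f ∈ symmDiff S {f} then F (symmDiff S {f}) else 0) = _
    by_cases hf : f ∈ S
    · simp [Finset.mem_symmDiff, hf]
    · have : symmDiff S {f} = insert f S := by
        ext a
        by_cases ha : a = f <;> simp [Finset.mem_symmDiff, ha, hf]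
      simp [this, hf]
  calc ∑' S, F S = ∑' S, ((if f ∈ S then 0 else F S) + (if f ∈ S then F S else 0)) :=
        tsum_congr fun S => by split_ifs <;> simp
    _ = ∑' S, ((if f ∈ S then 0 else F S) + (if f ∈ S then 0 else F (insert f S))) := by
        rw [ENNReal.tsum_add, ENNReal.tsum_add, h1]
    _ = _ := tsum_congr fun S => by split_ifs <;> simp

theorem mass_split [DecidableEq ι] (y : ι → ℝ≥0∞) (g : Finset ι → ℝ≥0∞) (f : ι) :
    mass y g = ∑' S, if f ∈ S then 0 else (∏ e ∈ S, y e) * (g S + y f * g (insert f S)) := by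
  rw [mass, tsum_finset_split _ f]
  refine tsum_congr fun S => ?_
  split_ifs with hf
  · rfl
  · rw [Finset.prod_insert hf]; ring

theorem mass_add (y : ι → ℝ≥0∞) (g h : Finset ι → ℝ≥0∞) :
    mass y (fun S => g S + h S) = mass y g + mass y h := by
  simp [mass, mul_add, ENNReal.tsum_add]

theorem mass_mono (y : ι → ℝ≥0∞) {g h : Finset ι → ℝ≥0∞}
    (H : ∀ S, (∏ f ∈ S, y f) ≠ 0 → g S ≤ h S) : mass y g ≤ mass y h := by
  refine ENNReal.tsum_le_tsum fun S => ?_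
  by_cases hS : (∏ f ∈ S, y f) = 0
  · simp [hS]
  · gcongr; exact H S hS

theorem mass_congr (y : ι → ℝ≥0∞) {g h : Finset ι → ℝ≥0∞}
    (H : ∀ S, (∏ f ∈ S, y f) ≠ 0 → g S = h S) : mass y g = mass y h :=
  le_antisymm (mass_mono y fun S hS => (H S hS).le) (mass_mono y fun S hS => (H S hS).ge)

theorem mass_tsum {κ : Type*} (y : ι → ℝ≥0∞) (g : κ → Finset ι → ℝ≥0∞) :
    mass y (fun S => ∑' k, g k S) = ∑' k, mass y (g k) := by
  simp only [mass, ← ENNReal.tsum_mul_left]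
  exact ENNReal.tsum_comm

theorem apply_empty_le_mass (y : ι → ℝ≥0∞) (g : Finset ι → ℝ≥0∞) : g ∅ ≤ mass y g := by
  simpa [mass] using ENNReal.le_tsum (f := fun S : Finset ι => (∏ f ∈ S, y f) * g S) ∅

theorem mass_mem [DecidableEq ι] (y : ι → ℝ≥0∞) {g : Finset ι → ℝ≥0∞} {f : ι}
    (hg : ∀ S, g (insert f S) = g S) :
    mass y (fun S => if f ∈ S then g S else 0) * (1 + y f) = y f * mass y g := by
  rw [mass_split y _ f, mass_split y g f, ← ENNReal.tsum_mul_left, ← ENNReal.tsum_mul_right]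
  refine tsum_congr fun S => ?_
  by_cases hf : f ∈ S
  · simp [hf]
  · simp only [hf, if_false, Finset.mem_insert_self, if_true, hg]; ring

theorem mass_subset [DecidableEq ι] (y : ι → ℝ≥0∞) {g : Finset ι → ℝ≥0∞} (B : Finset ι)
    (hg : ∀ f ∈ B, ∀ S, g (insert f S) = g S) :
    mass y (fun S => if B ⊆ S then g S else 0) * ∏ f ∈ B, (1 + y f) =
      (∏ f ∈ B, y f) * mass y g := by
  induction B using Finset.induction_on with
  | empty => simp
  | insert f B hf ih =>
    have h1 : mass y (fun S => if insert f B ⊆ S then g S else 0) * (1 + y f) =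
        y f * mass y (fun S => if B ⊆ S then g S else 0) := by
      rw [← mass_mem y (f := f)]
      · congr 2
        funext S
        by_cases h : f ∈ S <;> simp [Finset.insert_subset_iff, h]
      · intro S
        simp only [Finset.subset_insert_iff_of_notMem hf, hg f (Finset.mem_insert_self _ _)]
    rw [Finset.prod_insert hf, Finset.prod_insert hf, ← mul_assoc, h1, mul_assoc,
      ih fun e he => hg e (Finset.mem_insert_of_mem he), mul_assoc]

theorem mass_one_ne_top {y : ι → ℝ≥0∞} (hy : ∑' f, y f ≠ ∞) : mass y (fun _ => 1) ≠ ∞ := by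
  classical
  have hfin : ∀ f, y f ≠ ∞ := ENNReal.ne_top_of_tsum_ne_top hy
  have hprod : ∀ F : Finset ι, ∏ f ∈ F, (1 + y f) ≤
      ENNReal.ofReal (Real.exp (∑' f, y f).toReal) := by
    intro F
    have h1 : ∏ f ∈ F, (1 + y f) ≤ ∏ f ∈ F, ENNReal.ofReal (Real.exp (y f).toReal) := by
      refine Finset.prod_le_prod' fun f _ => ?_
      calc 1 + y f = ENNReal.ofReal (1 + (y f).toReal) := by
            rw [ENNReal.ofReal_add zero_le_one ENNReal.toReal_nonneg, ENNReal.ofReal_one,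
              ENNReal.ofReal_toReal (hfin f)]
        _ ≤ _ := by
            gcongr
            rw [add_comm]
            exact Real.add_one_le_exp _
    refine h1.trans ?_
    rw [← ENNReal.ofReal_prod_of_nonneg fun _ _ => (Real.exp_pos _).le, ← Real.exp_sum,
      ← ENNReal.toReal_sum fun f _ => hfin f]
    gcongr
    exact ENNReal.sum_le_tsum F
  refine ne_top_of_le_ne_top (b := ENNReal.ofReal (Real.exp (∑' f, y f).toReal))
    ENNReal.ofReal_ne_top ?_
  rw [mass, ENNReal.tsum_eq_iSup_sum]
  refine iSup_le fun 𝒮 => ?_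
  refine le_trans ?_ (hprod (𝒮.sup id))
  simp only [mul_one]
  rw [Finset.prod_one_add]
  refine Finset.sum_le_sum_of_subset fun S hS => ?_
  rw [Finset.mem_powerset]
  exact Finset.le_sup (f := id) hS

end Weights

/-! ### Domain independent definability -/

section Definability

variable {σ : Schema.{v}} {U : Type u}

/-- `P` is defined, on the instances in `G`, by a first-order formula with free variables below `n`,
for every range of the quantifiers that contains the active domain. -/
def Definable (G : Set (Instance σ U)) (n : ℕ) (P : Instance σ U → (ℕ → U) → Prop) : Prop :=
  ∃ φ : Formula σ U, φ.free ⊆ Set.Iio n ∧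
    ∀ I ∈ G, ∀ A : Finset U, φ.activeDomain I ⊆ A → ∀ s, φ.Sat A I s ↔ P I s

/-- The valuation that takes the values `t` on the variables `b, …, b + n - 1`, and agrees with `s`
elsewhere. -/
def putBlock (b : ℕ) {n : ℕ} (t : Fin n → U) (s : ℕ → U) (x : ℕ) : U :=
  if h : b ≤ x ∧ x < b + n then t ⟨x - b, by omega⟩ else s x

theorem putBlock_of_lt {b n x : ℕ} (t : Fin n → U) (s : ℕ → U) (h : x < b) :
    putBlock b t s x = s x := dif_neg (by omega)

@[simp] theorem putBlock_add {b n : ℕ} (t : Fin n → U) (s : ℕ → U) (i : Fin n) :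
    putBlock b t s (b + i) = t i := by
  have : b ≤ b + i ∧ b + i < b + n := by omega
  simp [putBlock]

theorem putBlock_cons {b n : ℕ} (a : U) (t : Fin n → U) (s : ℕ → U) :
    putBlock b (Fin.cons a t : Fin (n + 1) → U) s =
      putBlock (b + 1) t (Function.update s b a) := by
  funext x
  unfold putBlock
  rcases lt_trichotomy x b with h | h | h
  · rw [dif_neg (by omega), dif_neg (by omega), Function.update_of_ne h.ne]
  · subst h
    rw [dif_pos (by omega), dif_neg (by omega), Function.update_self]
    simp
  · by_cases h' : x < b + (n + 1)
    · rw [dif_pos (by omega), dif_pos (by omega)]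
      have : (⟨x - b, by omega⟩ : Fin (n + 1)) = Fin.succ ⟨x - (b + 1), by omega⟩ :=
        Fin.ext (by simp; omega)
      rw [this, Fin.cons_succ]
    · rw [dif_neg (by omega), dif_neg (by omega), Function.update_of_ne h.ne']

namespace Formula

/-- Existential quantification over the variables `b, …, b + n - 1`. -/
def exBlock (φ : Formula σ U) : ℕ → ℕ → Formula σ U
  | _, 0 => φ
  | b, n + 1 => ex b (exBlock φ (b + 1) n)

theorem free_exBlock (φ : Formula σ U) (b n : ℕ) (h : φ.free ⊆ Set.Iio (b + n)) :
    (φ.exBlock b n).free ⊆ Set.Iio b := by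
  induction n generalizing b with
  | zero => exact h
  | succ n ih =>
    have := ih (b + 1) (by rwa [add_assoc, add_comm 1 n])
    intro x hx
    have h1 := this hx.1
    have h2 : x ≠ b := hx.2
    simp only [Set.mem_Iio] at h1 ⊢
    omega

@[simp] theorem consts_exBlock (φ : Formula σ U) (b n : ℕ) : (φ.exBlock b n).consts = φ.consts := by
  induction n generalizing b with
  | zero => rfl
  | succ n ih => exact ih (b + 1)

theorem sat_exBlock (φ : Formula σ U) (A : Finset U) (I : Instance σ U) (b n : ℕ) (s : ℕ → U) :
    (φ.exBlock b n).Sat A I s ↔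
      ∃ t : Fin n → U, (∀ i, t i ∈ A) ∧ φ.Sat A I (putBlock b t s) := by
  induction n generalizing b s with
  | zero =>
    have : ∀ t : Fin 0 → U, putBlock b t s = s := fun t => funext fun x => dif_neg (by omega)
    simp [exBlock, this]
  | succ n ih =>
    simp only [exBlock, Sat, ih]
    constructor
    · rintro ⟨a, ha, t, ht, h⟩
      refine ⟨Fin.cons a t, fun i => Fin.cases ha ht i, ?_⟩
      rwa [putBlock_cons]
    · rintro ⟨t, ht, h⟩
      refine ⟨t 0, ht 0, Fin.tail t, fun i => ht i.succ, ?_⟩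
      rwa [← putBlock_cons, Fin.cons_self_tail]

end Formula

variable {G : Set (Instance σ U)} {n : ℕ}

theorem Definable.congr {P Q : Instance σ U → (ℕ → U) → Prop} (hP : Definable G n P)
    (h : ∀ I ∈ G, ∀ s, P I s ↔ Q I s) : Definable G n Q := by
  obtain ⟨φ, hφ, H⟩ := hP
  exact ⟨φ, hφ, fun I hI A hA s => (H I hI A hA s).trans (h I hI s)⟩

theorem Definable.not {P : Instance σ U → (ℕ → U) → Prop} (hP : Definable G n P) :
    Definable G n fun I s => ¬ P I s := by
  obtain ⟨φ, hφ, H⟩ := hP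
  exact ⟨φ.not, hφ, fun I hI A hA s => not_congr (H I hI A hA s)⟩

theorem Definable.and {P Q : Instance σ U → (ℕ → U) → Prop} (hP : Definable G n P)
    (hQ : Definable G n Q) : Definable G n fun I s => P I s ∧ Q I s := by
  classical
  obtain ⟨φ, hφ, H⟩ := hP
  obtain ⟨ψ, hψ, K⟩ := hQ
  refine ⟨φ.and ψ, Set.union_subset hφ hψ, fun I hI A hA s => and_congr ?_ ?_⟩
  · refine H I hI A (subset_trans ?_ hA) s
    exact Finset.union_subset_union_right Finset.subset_union_left
  · refine K I hI A (subset_trans ?_ hA) s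
    exact Finset.union_subset_union_right Finset.subset_union_right

theorem Definable.or {P Q : Instance σ U → (ℕ → U) → Prop} (hP : Definable G n P)
    (hQ : Definable G n Q) : Definable G n fun I s => P I s ∨ Q I s :=
  (hP.not.and hQ.not).not.congr fun I _ s => by tauto

theorem Definable.imp {P Q : Instance σ U → (ℕ → U) → Prop} (hP : Definable G n P)
    (hQ : Definable G n Q) : Definable G n fun I s => P I s → Q I s :=
  (hP.not.or hQ).congr fun I _ s => by tauto

theorem definable_false : Definable G n fun _ _ => False := by
  refine ⟨.ex 0 (.not (.eq 0 (.var 0))), by simp [Formula.free, Term.vars], fun I _ A _ s => ?_⟩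
  simp [Formula.Sat, Term.val]

theorem definable_eq {x y : ℕ} (hx : x < n) (hy : y < n) : Definable G n fun _ s => s x = s y :=
  ⟨.eq x (.var y), by simp [Formula.free, Term.vars, Set.insert_subset_iff, hx, hy],
    fun _ _ _ _ _ => Iff.rfl⟩

theorem definable_eq_const {x : ℕ} (hx : x < n) (a : U) : Definable G n fun _ s => s x = a :=
  ⟨.eq x (.const a), by simp [Formula.free, Term.vars, hx], fun _ _ _ _ _ => Iff.rfl⟩

theorem definable_mem (f : Fact σ U) : Definable G n fun I _ => f ∈ I :=
  ⟨.rel f.1 fun i => .const (f.2 i), by simp [Formula.free, Term.vars], fun _ _ _ _ _ => Iff.rfl⟩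

theorem definable_exists_finset {κ : Type*} (T : Finset κ)
    {P : κ → Instance σ U → (ℕ → U) → Prop} (hP : ∀ k ∈ T, Definable G n (P k)) :
    Definable G n fun I s => ∃ k ∈ T, P k I s := by
  classical
  induction T using Finset.induction_on with
  | empty => simpa using definable_false
  | insert k T _ ih =>
    simp only [Finset.exists_mem_insert]
    exact (hP k (Finset.mem_insert_self _ _)).or
      (ih fun l hl => hP l (Finset.mem_insert_of_mem hl))

theorem definable_exists {κ : Type*} [Finite κ] {P : κ → Instance σ U → (ℕ → U) → Prop}
    (hP : ∀ k, Definable G n (P k)) : Definable G n fun I s => ∃ k, P k I s := by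
  have := Fintype.ofFinite κ
  simpa using definable_exists_finset Finset.univ fun k _ => hP k

theorem definable_forall {κ : Type*} [Finite κ] {P : κ → Instance σ U → (ℕ → U) → Prop}
    (hP : ∀ k, Definable G n (P k)) : Definable G n fun I s => ∀ k, P k I s :=
  (definable_exists fun k => (hP k).not).not.congr fun I _ s => by simp

theorem mem_adom {I : Instance σ U} {a : U} : a ∈ adom I ↔ ∃ f ∈ I, ∃ i, f.2 i = a := by
  classical
  simp [adom]

theorem definable_exists_fact (R : σ.Rel)
    {P : Instance σ U → (ℕ → U) → (Fin (σ.arity R) → U) → Prop}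
    (hP : Definable G (n + σ.arity R) fun I s => P I s fun i => s (n + i))
    (hs : ∀ I s s' t, (∀ x < n, s x = s' x) → P I s t → P I s' t) :
    Definable G n fun I s => ∃ t, (⟨R, t⟩ : Fact σ U) ∈ I ∧ P I s t := by
  classical
  obtain ⟨φ, hφ, H⟩ := hP
  refine ⟨((Formula.rel R fun i => .var (n + i)).and φ).exBlock n (σ.arity R),
    Formula.free_exBlock _ _ _ ?_, fun I hI A hA s => ?_⟩
  · refine Set.union_subset (Set.iUnion_subset fun i => ?_) hφ
    simp [Term.vars]
  · have hA' : φ.activeDomain I ⊆ A := by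
      refine subset_trans (Finset.union_subset_union_right ?_) hA
      rw [Formula.consts_exBlock]
      exact Finset.subset_union_right
    rw [Formula.sat_exBlock]
    simp only [Formula.Sat, Term.val, putBlock_add, H I hI A hA']
    constructor
    · rintro ⟨t, -, h, h'⟩
      exact ⟨t, h, hs _ _ _ _ (fun x hx => putBlock_of_lt _ _ hx) h'⟩
    · rintro ⟨t, h, h'⟩
      refine ⟨t, fun i => hA (Finset.mem_union_left _ (mem_adom.2 ⟨_, h, i, rfl⟩)), h, ?_⟩
      exact hs _ _ _ _ (fun x hx => (putBlock_of_lt _ _ hx).symm) h'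

variable {τ : Schema.{v}}

theorem definable_mem_const (D : Instance τ U) (R : τ.Rel) :
    Definable G (τ.arity R) fun _ s => (⟨R, fun i => s i⟩ : Fact τ U) ∈ D := by
  classical
  have h : ∀ f ∈ D, Definable G (τ.arity R) fun _ s =>
      ∃ h : f.1 = R, ∀ i : Fin (τ.arity R), s i = (h ▸ f.2 : Fin (τ.arity R) → U) i := by
    rintro ⟨R', t⟩ -
    by_cases h : R' = R
    · subst h
      simpa using definable_forall fun i => definable_eq_const i.2 (t i)
    · simpa [h] using definable_false
  refine (definable_exists_finset D h).congr fun I _ s => ?_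
  constructor
  · rintro ⟨⟨R', t⟩, hf, h, h'⟩
    dsimp only at h
    subst h
    simp only at h'
    rw [show (fun i : Fin (τ.arity R') => s i) = t from funext h']
    exact hf
  · exact fun hf => ⟨_, hf, rfl, fun i => rfl⟩

end Definability

/-! ### Images of weighted instances under definable maps -/

section Representation

variable {σ τ : Schema.{v}} {U : Type u}

namespace Formula

/-- A formula with the free variables of `φ` and the variables below `n`, and with the constants
of `φ` and of `C`. -/
def pad (φ : Formula σ U) : ℕ → List U → Formula σ U
  | 0, [] => φ
  | 0, a :: l => (φ.pad 0 l).and (.ex 0 (.eq 0 (.const a)))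
  | n + 1, l => (φ.pad n l).and (.eq n (.var n))

theorem free_pad (φ : Formula σ U) (n : ℕ) (l : List U) :
    (φ.pad n l).free = φ.free ∪ Set.Iio n := by
  induction n with
  | zero =>
    induction l with
    | nil => simp [pad]
    | cons a l ih => simp [pad, free, ih, Term.vars]
  | succ n ih =>
    ext x
    simp only [pad, free, ih, Term.vars, Set.mem_union, Set.mem_singleton_iff, Set.mem_Iio, or_self,
      Nat.lt_succ_iff_lt_or_eq, or_assoc]

theorem mem_consts_pad (φ : Formula σ U) (n : ℕ) (l : List U) {a : U} (ha : a ∈ l) :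
    a ∈ (φ.pad n l).consts := by
  induction n with
  | zero =>
    induction l with
    | nil => simp at ha
    | cons b l ih =>
      rcases List.mem_cons.1 ha with rfl | h
      · simp [pad, consts, Term.consts]
      · simp [pad, consts, ih h]
  | succ n ih => simp [pad, consts, ih]

end Formula

theorem Definable.exists_query {G : Set (Instance σ U)} {n : ℕ}
    {P : Instance σ U → (ℕ → U) → Prop} (hP : Definable G n P) (C : Finset U) :
    ∃ Φ : Query σ U n, (∀ i, Φ.vars i = i) ∧ C ⊆ Φ.formula.consts ∧
      ∀ I ∈ G, ∀ s, Φ.formula.Sat (Φ.formula.activeDomain I) I s ↔ P I s := by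
  classical
  obtain ⟨φ, hφ, H⟩ := hP
  refine ⟨⟨φ.and (.imp (φ.pad n C.toList) (φ.pad n C.toList)), fun i => i, Fin.val_injective, ?_⟩,
    fun i => rfl, fun a ha => ?_, fun I hI s => ?_⟩
  · have : φ.free ∪ Set.Iio n = Set.Iio n := Set.union_eq_right.2 hφ
    simp [Formula.free, Formula.free_pad, this]
  · simp [Formula.consts, Formula.mem_consts_pad φ n C.toList (Finset.mem_toList.2 ha)]
  · simp only [Formula.Sat, imp_self, and_true]
    exact H I hI _ (Finset.union_subset_union_right Finset.subset_union_left) s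

theorem Definable.imp_of_notMem {G G' : Set (Instance σ U)} {n : ℕ}
    {P : Instance σ U → (ℕ → U) → Prop} (hP : Definable G n P) (f : Fact σ U)
    (h : ∀ I ∈ G', f ∉ I → I ∈ G) : Definable G' n fun I s => f ∉ I → P I s := by
  classical
  obtain ⟨φ, hφ, H⟩ := hP
  obtain ⟨ψ, hψ, K⟩ := definable_mem (G := G') (n := n) f
  refine ⟨ψ.not.imp φ, Set.union_subset hψ hφ, fun I hI A hA s => ?_⟩
  have h1 : ψ.activeDomain I ⊆ A :=
    (Finset.union_subset_union_right Finset.subset_union_left).trans hA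
  have h2 : φ.activeDomain I ⊆ A :=
    (Finset.union_subset_union_right Finset.subset_union_right).trans hA
  simp only [Formula.Sat, K I hI A h1]
  exact forall_congr' fun hf => H I (h I hI hf) A h2 s

open Classical in
/-- `m` is, up to a constant factor, the image of a summable weighting of the finite sets of facts
over some schema under a first-order definable map. -/
def IsWeightedImage (m : Instance τ U → ℝ≥0∞) : Prop :=
  ∃ (σ : Schema.{v}) (y : Fact σ U → ℝ≥0∞) (V : Instance σ U → Instance τ U) (C : Finset U)
    (K : ℝ≥0∞), mass y (fun _ => 1) ≠ ∞ ∧ {f | y f = 0}.Infinite ∧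
    (∀ R, Definable {I | ∀ f ∈ I, y f ≠ 0} (τ.arity R)
      fun I s => (⟨R, fun i => s i⟩ : Fact τ U) ∈ V I) ∧
    (∀ I : Instance σ U, (∀ f ∈ I, y f ≠ 0) → ∀ a ∈ adom (V I), a ∈ adom I ∨ a ∈ C) ∧
    K ≠ 0 ∧ K ≠ ∞ ∧ ∀ D, mass y (fun I => if V I = D then 1 else 0) = K * m D

theorem mass_update {ι : Type*} [DecidableEq ι] {y : ι → ℝ≥0∞} {f : ι} (hf : y f = 0) (a : ℝ≥0∞)
    (g : Finset ι → ℝ≥0∞) :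
    mass (Function.update y f a) g = mass y (fun S => g S + a * g (insert f S)) := by
  rw [mass_split _ _ f, mass_split y _ f]
  refine tsum_congr fun S => ?_
  by_cases h : f ∈ S
  · simp [h]
  · simp only [h, if_false, Function.update_self, hf, zero_mul, add_zero]
    congr 1
    refine Finset.prod_congr rfl fun e he => Function.update_of_ne ?_ _ _
    rintro rfl
    exact h he

theorem mass_const {ι : Type*} (y : ι → ℝ≥0∞) (g : Finset ι → ℝ≥0∞) (a : ℝ≥0∞) :
    mass y (fun S => a * g S) = a * mass y g := by
  rw [mass, mass, ← ENNReal.tsum_mul_left]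
  exact tsum_congr fun S => by ring

open Classical in
theorem IsWeightedImage.add_single {m : Instance τ U → ℝ≥0∞} (hm : IsWeightedImage m)
    (D : Instance τ U) {a : ℝ≥0∞} (ha : a ≠ ∞) :
    IsWeightedImage fun D' => m D' + if D' = D then a else 0 := by
  obtain ⟨σ, y, V, C, K, hW, hinf, hdef, hadom, hK0, hK, hmass⟩ := hm
  obtain ⟨f, hf⟩ := hinf.nonempty
  have hW0 : mass y (fun _ => 1) ≠ 0 :=
    (zero_lt_one.trans_le (apply_empty_le_mass y fun _ => 1)).ne'
  have hG : ∀ {I : Instance σ U} {b : ℝ≥0∞}, (∀ e ∈ I, Function.update y f b e ≠ 0) → f ∉ I →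
      ∀ e ∈ I, y e ≠ 0 := by
    intro I b hI hfI e he
    have : e ≠ f := by rintro rfl; exact hfI he
    simpa [this] using hI e he
  set b : ℝ≥0∞ := K * a / mass y (fun _ => 1) with hb
  have hbtop : b ≠ ∞ := ENNReal.div_ne_top (ENNReal.mul_ne_top hK ha) hW0
  refine ⟨σ, Function.update y f b, fun I => if f ∈ I then D else V I, C ∪ adom D, K,
    ?_, ?_, fun R => ?_, fun I hI c hc => ?_, hK0, hK, fun D' => ?_⟩
  · rw [mass_update hf, mass_add, mass_const]
    exact ENNReal.add_ne_top.2 ⟨hW, ENNReal.mul_ne_top hbtop hW⟩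
  · refine (hinf.sdiff (Set.finite_singleton f)).mono ?_
    rintro e ⟨he, hef⟩
    have : e ≠ f := hef
    simpa [this] using he
  · refine (((definable_mem f).imp (definable_mem_const D R)).and
      ((hdef R).imp_of_notMem f fun I hI h => hG hI h)).congr fun I _ s => ?_
    by_cases h : f ∈ I <;> simp [h]
  · by_cases h : f ∈ I
    · simp only [h, if_true] at hc
      simp [hc]
    · simp only [h, if_false] at hc
      rcases hadom I (hG hI h) c hc with h | h
      · exact Or.inl h
      · simp [h]
  · have h1 : mass y (fun S => if (if f ∈ S then D else V S) = D' then 1 else 0) =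
        mass y (fun S => if V S = D' then 1 else 0) := by
      refine mass_congr y fun S hS => ?_
      have : f ∉ S := fun h => hS (Finset.prod_eq_zero h hf)
      simp [this]
    rw [mass_update hf, mass_add, mass_const, h1, hmass, mul_add]
    congr 1
    by_cases h : D' = D
    · simp only [Finset.mem_insert_self, if_true, h]
      rw [hb, ENNReal.div_mul_cancel hW0 hW]
    · have h' : D ≠ D' := fun e => h e.symm
      simp [h, h', mass]

theorem prod_one_add_ne_top {ι : Type*} {y : ι → ℝ≥0∞} (hW : mass y (fun _ => 1) ≠ ∞)
    (C : Finset ι) :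
    ∏ f ∈ C, (1 + y f) ≠ ∞ := by
  refine ENNReal.prod_ne_top fun f _ => ENNReal.add_ne_top.2 ⟨ENNReal.one_ne_top, ?_⟩
  refine ne_top_of_le_ne_top hW ?_
  simpa [mass] using ENNReal.le_tsum (f := fun S : Finset ι => (∏ f ∈ S, y f) * 1) {f}

theorem mass_subset_div {ι : Type*} [DecidableEq ι] {y : ι → ℝ≥0∞}
    (hW : mass y (fun _ => 1) ≠ ∞) (B : Finset ι) :
    mass y (fun S => if B ⊆ S then 1 else 0) / mass y (fun _ => 1) =
      ∏ f ∈ B, y f / (1 + y f) := by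
  have hW0 : mass y (fun _ => 1) ≠ 0 :=
    (zero_lt_one.trans_le (apply_empty_le_mass y fun _ => 1)).ne'
  have h := mass_subset y (g := fun _ => 1) B fun _ _ _ => rfl
  have h0 : ∏ f ∈ B, (1 + y f) ≠ 0 := Finset.prod_ne_zero_iff.2 fun f _ => by simp
  have htop := prod_one_add_ne_top hW B
  symm
  rw [ENNReal.eq_div_iff hW0 hW]
  simp only [div_eq_mul_inv, Finset.prod_mul_distrib]
  rw [← ENNReal.prod_inv_distrib fun f _ e _ _ => Or.inl (by simp), ← mul_assoc,
    mul_comm (mass y _), ← h, mul_assoc, ENNReal.mul_inv_cancel h0 htop, mul_one]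

open Classical in
theorem IsWeightedImage.inFOTI [Countable U] [Nonempty U] (𝒟 : PDB τ U)
    (h : IsWeightedImage fun D : Instance τ U =>
      if hD : D ∈ 𝒟.space then 𝒟.law ⟨D, hD⟩ else 0) : 𝒟.InFOTI := by
  obtain ⟨σ, y, V, C, K, hW, -, hdef, hadom, hK0, hK, hmass⟩ := h
  have hW0 : mass y (fun _ => 1) ≠ 0 :=
    (zero_lt_one.trans_le (apply_empty_le_mass y fun _ => 1)).ne'
  set W := mass y (fun _ => 1) with hWdef
  choose Φ hvars hC hsat using fun R => (hdef R).exists_query C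
  obtain ⟨Ψ, hΨ⟩ : ∃ Ψ : FOView σ τ U, ∀ I : Instance σ U, (∀ f ∈ I, y f ≠ 0) →
      Ψ.apply I = V I := by
    refine ⟨Φ, fun I hI => ?_⟩
    ext ⟨R, a⟩
    have key : ∀ s : ℕ → U, (∀ i, s ((Φ R).vars i) = a i) →
        ((Φ R).formula.Sat ((Φ R).formula.activeDomain I) I s ↔ (⟨R, a⟩ : Fact τ U) ∈ V I) := by
      intro s hs
      rw [hsat R I hI]
      simp only [hvars] at hs
      rw [show (fun i : Fin (τ.arity R) => s i) = a from funext hs]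
    simp only [FOView.apply, Query.answer, Finset.mem_sigma, Finset.mem_univ, true_and,
      Finset.mem_filter, Fintype.mem_piFinset]
    constructor
    · rintro ⟨-, s, hs, h⟩
      exact (key s hs).1 h
    · intro h
      refine ⟨fun i => ?_, ?_⟩
      · rcases hadom I hI (a i) (mem_adom.2 ⟨_, h, i, rfl⟩) with h' | h'
        · exact Finset.mem_union_left _ h'
        · exact Finset.mem_union_right _ (hC R h')
      · obtain ⟨s, hs⟩ : ∃ s : ℕ → U, ∀ i, s ((Φ R).vars i) = a i := by
          refine ⟨fun x => if hx : x < τ.arity R then a ⟨x, hx⟩ else Classical.arbitrary U,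
            fun i => ?_⟩
          simp [hvars]
        exact ⟨s, hs, (key s hs).2 h⟩
  set X : Set (Instance σ U) := {I | (∀ f ∈ I, y f ≠ 0) ∧ V I ∈ 𝒟.space} with hX
  have hmem : ∀ I : Instance σ U, (∏ f ∈ I, y f) ≠ 0 → I ∈ X := by
    intro I hI
    refine ⟨Finset.prod_ne_zero_iff.1 hI, ?_⟩
    by_contra hV
    have h1 := hmass (V I)
    simp only [dif_neg hV, mul_zero] at h1
    rw [mass, ENNReal.tsum_eq_zero] at h1
    exact hI (by simpa using h1 I)
  have hsum : ∀ p : Instance σ U → Prop,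
      ∑' I : X, (if p I then (∏ f ∈ (I : Instance σ U), y f) / W else 0) =
        mass y (fun I => if p I then 1 else 0) / W := by
    intro p
    rw [tsum_subtype_eq_of_support_subset
      (f := fun I : Instance σ U => if p I then (∏ f ∈ I, y f) / W else 0), mass, div_eq_mul_inv,
      ← ENNReal.tsum_mul_right]
    · refine tsum_congr fun I => ?_
      split_ifs <;> simp [div_eq_mul_inv]
    · intro I hI
      refine hmem I fun h0 => hI ?_
      simp [h0]
  have hcount : Countable (Instance σ U) := by
    have : Countable (Fact σ U) := inferInstance
    infer_instance
  let 𝓘 : PDB σ U :=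
    { space := X
      countable_space := X.to_countable
      law := ⟨fun I => (∏ f ∈ (I : Instance σ U), y f) / W, by
        rw [ENNReal.summable.hasSum_iff]
        have := hsum fun _ => True
        simpa [← hWdef, ENNReal.div_self hW0 hW] using this⟩ }
  have hprob : ∀ p : Instance σ U → Prop,
      𝓘.prob p = mass y (fun I => if p I then 1 else 0) / W := by
    intro p
    rw [← hsum, PDB.prob, PMF.toOuterMeasure_apply]
    refine tsum_congr fun I => ?_
    rw [Set.indicator_apply]
    rfl
  refine ⟨σ, 𝓘, Ψ, fun S _ => ?_, fun I hI => ?_, fun D => ?_⟩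
  · have h1 : ∀ S : Finset (Fact σ U), 𝓘.prob (fun I => ∀ f ∈ S, f ∈ I) =
        ∏ f ∈ S, y f / (1 + y f) := by
      intro S
      rw [hprob, ← mass_subset_div hW S]
      congr 2
      funext I
      congr
    rw [h1]
    refine Finset.prod_congr rfl fun f _ => ?_
    simpa using (h1 {f}).symm
  · rw [hΨ I hI.1]
    exact hI.2
  · have h1 : 𝓘.prob (fun I => Ψ.apply I = D) =
        mass y (fun I => if V I = D then 1 else 0) / W := by
      rw [hprob]
      congr 1
      refine mass_congr y fun I hI => ?_
      simp only [hΨ I (hmem I hI).1]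
    have h2 : W = K := by
      have h3 : W = ∑' D, mass y (fun I => if V I = D then 1 else 0) := by
        rw [← mass_tsum]
        exact mass_congr y fun I _ => by simp
      rw [h3]
      simp only [hmass]
      rw [ENNReal.tsum_mul_left]
      convert mul_one K
      rw [← 𝒟.law.tsum_coe, ← tsum_subtype_eq_of_support_subset (s := 𝒟.space)]
      · exact tsum_congr fun D => by simp
      · intro D hD
        by_contra h
        simp [h] at hD
    rw [h1, hmass, h2]
    simp only [D.2, dif_pos, Subtype.coe_eta]
    rw [ mul_comm, mul_div_assoc, ENNReal.div_self hK0 hK, mul_one]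

end Representation

/-! ### Blocks of facts -/

section Blocks

open Classical

variable {ι κ : Type*} {y : ι → ℝ≥0∞} {B : κ → Finset ι} {o : κ → ℝ≥0∞}

theorem mass_ne_top {g : Finset ι → ℝ≥0∞} (hW : mass y (fun _ => 1) ≠ ∞) (hg : ∀ S, g S ≤ 1) :
    mass y g ≠ ∞ :=
  ne_top_of_le_ne_top hW (mass_mono y fun S _ => hg S)

theorem mass_subset_mul_one_add [DecidableEq ι] (hW : mass y (fun _ => 1) ≠ ∞) {C : Finset ι}
    {a : ℝ≥0∞}
    (ha : (∏ f ∈ C, y f) * (1 + a) = a * ∏ f ∈ C, (1 + y f)) {g : Finset ι → ℝ≥0∞}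
    (hg : ∀ f ∈ C, ∀ S, g (insert f S) = g S) :
    mass y (fun S => if C ⊆ S then g S else 0) * (1 + a) = a * mass y g := by
  have h := mass_subset y C hg
  have h0 : ∏ f ∈ C, (1 + y f) ≠ 0 := Finset.prod_ne_zero_iff.2 fun f _ => by simp
  have htop := prod_one_add_ne_top hW C
  rw [← ENNReal.mul_left_inj h0 htop, mul_right_comm, h, mul_right_comm, ha]
  ring

theorem mass_unique_block [DecidableEq ι] (hW : mass y (fun _ => 1) ≠ ∞)
    (hB : Pairwise fun d d' => Disjoint (B d) (B d')) (ho : ∀ d, o d ≠ ∞)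
    (hyo : ∀ d, (∏ f ∈ B d, y f) * (1 + o d) = o d * ∏ f ∈ B d, (1 + y f)) (d : κ) :
    mass y (fun S => if B d ⊆ S ∧ ∀ d', B d' ⊆ S → d' = d then 1 else 0) =
      o d * mass y (fun S => if ∀ d, ¬ B d ⊆ S then 1 else 0) := by
  set g : Finset ι → ℝ≥0∞ := fun S => if ∀ d', B d' ⊆ S → d' = d then 1 else 0 with hg
  have h1 := mass_subset_mul_one_add hW (hyo d) (g := g) fun f hf S => by
    simp only [hg]
    congr 1
    refine propext (forall_congr' fun d' => ?_)
    by_cases h : d' = d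
    · simp [h]
    · rw [Finset.subset_insert_iff_of_notMem]
      exact fun hf' => Finset.disjoint_left.1 (hB h) hf' hf
  have e : (fun S => if B d ⊆ S ∧ ∀ d', B d' ⊆ S → d' = d then (1 : ℝ≥0∞) else 0) =
      fun S => if B d ⊆ S then g S else 0 := by
    funext S
    by_cases h : B d ⊆ S <;> simp [h, hg]
  have h2 : mass y g = mass y (fun S => if ∀ d, ¬ B d ⊆ S then 1 else 0) +
      mass y (fun S => if B d ⊆ S then g S else 0) := by
    rw [← mass_add]
    congr 1
    funext S
    by_cases h : B d ⊆ S
    · have : ¬ ∀ d, ¬ B d ⊆ S := fun h' => h' d h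
      simp [h, this]
    · have : (∀ d', B d' ⊆ S → d' = d) ↔ ∀ d', ¬ B d' ⊆ S :=
        ⟨fun h' d' hd' => h (h' d' hd' ▸ hd'), fun h' d' hd' => absurd hd' (h' d')⟩
      simp [h, hg, this]
  rw [e]
  set C := mass y (fun S => if B d ⊆ S then g S else 0) with hC
  have hCtop : C ≠ ∞ := mass_ne_top hW fun S => by
    simp only [hg]
    split_ifs <;> simp
  rw [h2, mul_add, mul_add, mul_one, mul_comm C (o d)] at h1
  exact (ENNReal.add_left_inj (ENNReal.mul_ne_top (ho d) hCtop)).1 h1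

theorem mass_le_two_mul_no_block [DecidableEq ι] (hW : mass y (fun _ => 1) ≠ ∞)
    (hyo : ∀ d, (∏ f ∈ B d, y f) * (1 + o d) = o d * ∏ f ∈ B d, (1 + y f))
    (hsum : ∑' d, o d ≤ 2⁻¹) :
    mass y (fun _ => 1) ≤ 2 * mass y (fun S => if ∀ d, ¬ B d ⊆ S then 1 else 0) := by
  set W := mass y (fun _ => 1) with hWdef
  set N := mass y (fun S => if ∀ d, ¬ B d ⊆ S then 1 else 0)
  have h1 : W ≤ N + ∑' d, mass y (fun S => if B d ⊆ S then 1 else 0) := by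
    rw [← mass_tsum, ← mass_add]
    refine mass_mono y fun S _ => ?_
    by_cases h : ∀ d, ¬ B d ⊆ S
    · simp [h]
    · obtain ⟨d, hd⟩ := _root_.not_forall_not.1 h
      refine le_add_left ?_
      simpa [hd] using ENNReal.le_tsum (f := fun d => if B d ⊆ S then (1 : ℝ≥0∞) else 0) d
  have h2 : ∀ d, mass y (fun S => if B d ⊆ S then 1 else 0) ≤ o d * W := fun d => by
    rw [hWdef, ← mass_subset_mul_one_add hW (hyo d) (g := fun _ => 1) fun _ _ _ => rfl]
    exact le_mul_of_one_le_right' le_self_add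
  have h3 : W ≤ N + 2⁻¹ * W :=
    h1.trans (by
      gcongr
      refine (ENNReal.tsum_le_tsum h2).trans ?_
      rw [ENNReal.tsum_mul_right]
      gcongr)
  have h4 : W + W ≤ 2 * N + W := by
    calc W + W = 2 * W := (two_mul W).symm
      _ ≤ 2 * (N + 2⁻¹ * W) := by gcongr
      _ = 2 * N + W := by
        rw [mul_add, ← mul_assoc, ENNReal.mul_inv_cancel two_ne_zero ENNReal.ofNat_ne_top, one_mul]
  exact (ENNReal.add_le_add_iff_right hW).1 h4

end Blocks

/-! ### Segmented instances -/

/-- The argument positions of a segment: the identifier of the instance, the segment's own position,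
the position of the next segment, and the contents, `m` facts of arity at most `r`, each listed as a
code of the relation symbol followed by the arguments. -/
abbrev Slot (m r : ℕ) : Type := Fin 3 ⊕ (Fin m × Option (Fin r))

/-- The schema with a single relation symbol, for segments. -/
abbrev segSchema (m r : ℕ) : Schema.{v} where
  Rel := PUnit
  arity _ := Fintype.card (Slot m r)

/-- An enumeration of the argument positions. -/
noncomputable def slotEquiv (m r : ℕ) : Slot m r ≃ Fin (Fintype.card (Slot m r)) :=
  Fintype.equivFin (Slot m r)

variable {U : Type u} {m r : ℕ}

/-- The fact with the given arguments. -/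
noncomputable def segFact (t : Slot m r → U) : Fact (segSchema.{v} m r) U :=
  ⟨PUnit.unit, fun i => t ((slotEquiv m r).symm i)⟩

theorem segFact_injective :
    Function.Injective (segFact : (Slot m r → U) → Fact (segSchema.{v} m r) U) := by
  intro t t' h
  have h' := eq_of_heq (Sigma.mk.inj h).2
  funext p
  have h2 : t ((slotEquiv m r).symm (slotEquiv m r p)) =
    t' ((slotEquiv m r).symm (slotEquiv m r p)) := congrFun h' (slotEquiv m r p)
  simpa only [Equiv.symm_apply_apply] using h2

theorem segFact_comp (t : Fin (Fintype.card (Slot m r)) → U) :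
    segFact (t ∘ slotEquiv m r) = (⟨PUnit.unit, t⟩ : Fact (segSchema.{v} m r) U) := by
  have : (fun i => (t ∘ slotEquiv m r) ((slotEquiv m r).symm i)) = t := by
    funext i
    simp
  rw [segFact, this]

theorem mem_adom_of_segFact {I : Instance (segSchema.{v} m r) U} {t : Slot m r → U}
    (h : segFact t ∈ I) (p : Slot m r) : t p ∈ adom I :=
  mem_adom.2 ⟨_, h, slotEquiv m r p, congrArg t ((slotEquiv m r).symm_apply_apply p)⟩

section Definability

variable {G : Set (Instance (segSchema.{v} m r) U)} {n : ℕ}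

theorem exists_segFact {I : Instance (segSchema.{v} m r) U} {P : (Slot m r → U) → Prop} :
    (∃ t, (⟨PUnit.unit, t⟩ : Fact (segSchema.{v} m r) U) ∈ I ∧ P (t ∘ slotEquiv m r)) ↔
      ∃ t, segFact t ∈ I ∧ P t := by
  constructor
  · rintro ⟨t, ht, h⟩
    exact ⟨_, by rwa [segFact_comp], h⟩
  · rintro ⟨t, ht, h⟩
    refine ⟨t ∘ (slotEquiv m r).symm, ht, ?_⟩
    have : (t ∘ (slotEquiv m r).symm) ∘ slotEquiv m r = t := by
      funext p
      simp
    rwa [this]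

theorem definable_exists_segFact
    {P : Instance (segSchema.{v} m r) U → (ℕ → U) → (Slot m r → U) → Prop}
    (hP : Definable G (n + Fintype.card (Slot m r))
      fun I s => P I s fun p => s (n + slotEquiv m r p))
    (hs : ∀ I s s' t, (∀ x < n, s x = s' x) → P I s t → P I s' t) :
    Definable G n fun I s => ∃ t, segFact t ∈ I ∧ P I s t :=
  (definable_exists_fact (σ := segSchema m r) PUnit.unit
    (P := fun I s t => P I s (t ∘ slotEquiv m r)) hP fun I s s' _ h => hs I s s' _ h).congr
    fun _ _ _ => exists_segFact

theorem definable_forall_segFact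
    {P : Instance (segSchema.{v} m r) U → (ℕ → U) → (Slot m r → U) → Prop}
    (hP : Definable G (n + Fintype.card (Slot m r))
      fun I s => P I s fun p => s (n + slotEquiv m r p))
    (hs : ∀ I s s' t, (∀ x < n, s x = s' x) → P I s t → P I s' t) :
    Definable G n fun I s => ∀ t, segFact t ∈ I → P I s t :=
  (definable_exists_segFact (P := fun I s t => ¬ P I s t) hP.not fun I s s' t h h' h'' =>
    h' (hs I s' s t (fun x hx => (h x hx).symm) h'')).not.congr fun I _ s => by simp

theorem slot_lt (n : ℕ) (p : Slot m r) :
    n + (slotEquiv m r p : ℕ) < n + Fintype.card (Slot m r) :=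
  Nat.add_lt_add_left (slotEquiv m r p).2 n

/-- The segments with identifier `a` exist, and are closed under passing to the next one. -/
def ChainClosed (I : Instance (segSchema.{v} m r) U) (a : U) : Prop :=
  (∃ t, segFact t ∈ I ∧ t (.inl 0) = a) ∧
    ∀ t, segFact t ∈ I → t (.inl 0) = a →
      ∃ t', segFact t' ∈ I ∧ t' (.inl 0) = a ∧ t' (.inl 1) = t (.inl 2)

theorem definable_chainClosed {x : ℕ} (hx : x < n) :
    Definable G n fun I s => ChainClosed I (s x) := by
  refine .and (definable_exists_segFact (P := fun I s t => t (.inl 0) = s x)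
    (definable_eq (slot_lt _ _) (Nat.lt_add_right _ hx)) ?_)
    (definable_forall_segFact (P := fun I s t => t (.inl 0) = s x → _)
      (.imp (definable_eq (slot_lt _ _) (by omega))
        (definable_exists_segFact
          (P := fun I s t' => t' (.inl 0) = s x ∧ t' (.inl 1) = s (n + slotEquiv m r (.inl 2)))
          (.and (definable_eq (slot_lt _ _) (Nat.lt_add_right _ (Nat.lt_add_right _ hx)))
            (definable_eq (slot_lt _ _) (Nat.lt_add_right _ (slot_lt _ _)))) ?_)) ?_)
  · intro I s s' t h h'
    rw [← h x hx, h']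
  · rintro I s s' t h ⟨h1, h2⟩
    rw [← h x (by omega), ← h _ (slot_lt _ _)]
    exact ⟨h1, h2⟩
  · intro I s s' t h h'
    rwa [← h x hx]

/-- The identifier `a` is the only one whose segments form a closed chain. -/
def UniqueChain (I : Instance (segSchema.{v} m r) U) (a : U) : Prop :=
  ChainClosed I a ∧ ∀ t, segFact t ∈ I → ChainClosed I (t (.inl 0)) → t (.inl 0) = a

theorem definable_uniqueChain {x : ℕ} (hx : x < n) :
    Definable G n fun I s => UniqueChain I (s x) := by
  refine (definable_chainClosed hx).and (definable_forall_segFact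
    (P := fun I s t => ChainClosed I (t (.inl 0)) → t (.inl 0) = s x)
    ((definable_chainClosed (slot_lt _ _)).imp (definable_eq (slot_lt _ _) (by omega))) ?_)
  intro I s s' t h h'
  rwa [← h x hx]

theorem definable_exists_uniqueChain :
    Definable G n fun I _ => ∃ t, segFact t ∈ I ∧ UniqueChain I (t (.inl 0)) :=
  definable_exists_segFact (P := fun I _ t => UniqueChain I (t (.inl 0)))
    (definable_uniqueChain (slot_lt _ _)) fun _ _ _ _ _ h => h

theorem definable_exists_listed {a : ℕ} (ha : a ≤ r) (c : U) :
    Definable G a fun I s => ∃ t, segFact t ∈ I ∧ UniqueChain I (t (.inl 0)) ∧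
      ∃ l : Fin m, t (.inr (l, none)) = c ∧
        ∀ i : Fin a, t (.inr (l, some (i.castLE ha))) = s i := by
  refine definable_exists_segFact
    (P := fun I s t => UniqueChain I (t (.inl 0)) ∧ ∃ l : Fin m, t (.inr (l, none)) = c ∧
      ∀ i : Fin a, t (.inr (l, some (i.castLE ha))) = s i)
    ((definable_uniqueChain (slot_lt _ _)).and (definable_exists fun l =>
      (definable_eq_const (slot_lt _ _) c).and (definable_forall fun i =>
        definable_eq (slot_lt _ _) (by omega)))) ?_
  rintro I s s' t h ⟨h1, l, h2, h3⟩
  exact ⟨h1, l, h2, fun i => by rw [← h i i.2]; exact h3 i⟩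

end Definability

/-- A family of instances over `τ`, each partitioned into a cycle of segments of at most `m` facts
each, with identifiers, positions and codes of relation symbols in `U`. -/
structure Segmentation (τ : Schema.{v}) (U : Type u) (κ : Type w) (m r : ℕ) where
  inst : κ → Instance τ U
  ident : κ → U
  node : ℕ → U
  code : τ.Rel → U
  filler : U
  len : κ → ℕ
  part : (d : κ) → Fin (len d + 1) → Fin m → Fact τ U
  mem_inst : ∀ d f, f ∈ inst d ↔ ∃ j l, part d j l = f
  ident_injective : ident.Injective
  node_injective : node.Injective
  code_injective : code.Injective
  infinite_compl : (Set.range ident)ᶜ.Infinite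
  arity_le : ∀ R, τ.arity R ≤ r

namespace Segmentation

variable {τ : Schema.{v}} {κ : Type w} (E : Segmentation τ U κ m r)

/-- The code of a fact: the code of its relation symbol, and its arguments. -/
def encode (f : Fact τ U) : Option (Fin r) → U
  | none => E.code f.1
  | some i => if h : (i : ℕ) < τ.arity f.1 then f.2 ⟨i, h⟩ else E.filler

theorem encode_iff (f : Fact τ U) (R : τ.Rel) (x : Fin (τ.arity R) → U) :
    (E.encode f none = E.code R ∧
      ∀ i : Fin (τ.arity R), E.encode f (some (i.castLE (E.arity_le R))) = x i) ↔ f = ⟨R, x⟩ := by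
  obtain ⟨R', x'⟩ := f
  simp only [encode, E.code_injective.eq_iff]
  constructor
  · rintro ⟨h, h'⟩
    subst h
    congr 1
    funext i
    simpa using h' i
  · intro h
    obtain ⟨rfl, h⟩ := Sigma.mk.inj h
    obtain rfl := eq_of_heq h
    simp

/-- The `j`-th segment of the instance `d`. -/
def seg (d : κ) (j : Fin (E.len d + 1)) : Slot m r → U :=
  Sum.elim ![E.ident d, E.node j, E.node (j + 1 : Fin (E.len d + 1))]
    fun p => E.encode (E.part d j p.1) p.2

theorem seg_ident (d : κ) (j : Fin (E.len d + 1)) : E.seg d j (.inl 0) = E.ident d := rfl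

theorem seg_node (d : κ) (j : Fin (E.len d + 1)) : E.seg d j (.inl 1) = E.node j := rfl

theorem seg_next (d : κ) (j : Fin (E.len d + 1)) :
    E.seg d j (.inl 2) = E.node (j + 1 : Fin (E.len d + 1)) := rfl

theorem seg_lists (d : κ) (j : Fin (E.len d + 1)) (l : Fin m) (R : τ.Rel)
    (x : Fin (τ.arity R) → U) :
    (E.seg d j (.inr (l, none)) = E.code R ∧
      ∀ i : Fin (τ.arity R), E.seg d j (.inr (l, some (i.castLE (E.arity_le R)))) = x i) ↔
      E.part d j l = ⟨R, x⟩ :=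
  E.encode_iff (E.part d j l) R x

theorem segFact_seg_injective : Function.Injective
    fun p : (d : κ) × Fin (E.len d + 1) =>
      (segFact (E.seg p.1 p.2) : Fact (segSchema.{v} m r) U) := by
  rintro ⟨d, j⟩ ⟨d', j'⟩ h
  have h' := segFact_injective h
  have h1 : d = d' := E.ident_injective (congrFun h' (.inl 0))
  subst h1
  have h2 : j = j' := Fin.ext (E.node_injective (congrFun h' (.inl 1)))
  rw [h2]

open Classical in
/-- The set of all segments of the instance `d`. -/
noncomputable def block (d : κ) : Instance (segSchema.{v} m r) U :=
  Finset.univ.image fun j => segFact (E.seg d j)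

theorem mem_block {d : κ} {f : Fact (segSchema.{v} m r) U} :
    f ∈ E.block d ↔ ∃ j, segFact (E.seg d j) = f := by simp [block]

theorem chainClosed_iff {I : Instance (segSchema.{v} m r) U}
    (hI : ∀ f ∈ I, ∃ d j, segFact (E.seg d j) = f) {d : κ} :
    ChainClosed I (E.ident d) ↔ E.block d ⊆ I := by
  have hI' : ∀ t, segFact t ∈ I → t (.inl 0) = E.ident d → ∃ j, t = E.seg d j := by
    intro t ht h
    obtain ⟨d', j, h'⟩ := hI _ ht
    obtain rfl := segFact_injective h'
    obtain rfl := E.ident_injective h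
    exact ⟨j, rfl⟩
  constructor
  · rintro ⟨⟨t, ht, h⟩, hc⟩ f hf
    obtain ⟨j, rfl⟩ := hI' t ht h
    have hstep : ∀ i, segFact (E.seg d i) ∈ I → segFact (E.seg d (i + 1)) ∈ I := by
      intro i hi
      obtain ⟨t', ht', h1, h2⟩ := hc _ hi rfl
      obtain ⟨i', rfl⟩ := hI' t' ht' h1
      rw [seg_node, seg_next] at h2
      rwa [← Fin.ext (E.node_injective h2)]
    have hall : ∀ n : ℕ, segFact (E.seg d (j + Fin.ofNat (E.len d + 1) n)) ∈ I := by
      intro n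
      induction n with
      | zero => simpa using ht
      | succ n ih =>
        have h1 : Fin.ofNat (E.len d + 1) (n + 1) = Fin.ofNat (E.len d + 1) n + 1 :=
          Fin.ext (by simp [Fin.val_add])
        rw [h1, ← add_assoc]
        exact hstep _ ih
    obtain ⟨i, rfl⟩ := E.mem_block.1 hf
    simpa using hall ((i - j : Fin (E.len d + 1)) : ℕ)
  · intro h
    refine ⟨⟨_, h (E.mem_block.2 ⟨0, rfl⟩), rfl⟩, fun t ht hd => ?_⟩
    obtain ⟨j, rfl⟩ := hI' t ht hd
    exact ⟨_, h (E.mem_block.2 ⟨j + 1, rfl⟩), rfl, rfl⟩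

theorem uniqueChain_iff {I : Instance (segSchema.{v} m r) U}
    (hI : ∀ f ∈ I, ∃ d j, segFact (E.seg d j) = f) {d : κ} :
    UniqueChain I (E.ident d) ↔ E.block d ⊆ I ∧ ∀ d', E.block d' ⊆ I → d' = d := by
  rw [UniqueChain, E.chainClosed_iff hI]
  refine and_congr_right fun _ => ⟨fun h d' hd' => ?_, fun h t ht hc => ?_⟩
  · exact E.ident_injective (h _ (hd' (E.mem_block.2 ⟨0, rfl⟩)) ((E.chainClosed_iff hI).2 hd'))
  · obtain ⟨d', j, h'⟩ := hI _ ht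
    obtain rfl := segFact_injective h'
    rw [seg_ident] at hc ⊢
    rw [h d' ((E.chainClosed_iff hI).1 hc)]

open Classical in
/-- The unique instance all of whose segments are present, or `D₀` if there is no such instance. -/
noncomputable def decode (D₀ : Instance τ U) (I : Instance (segSchema.{v} m r) U) : Instance τ U :=
  if h : ∃ d, E.block d ⊆ I ∧ ∀ d', E.block d' ⊆ I → d' = d then E.inst h.choose else D₀

theorem decode_of_unique (D₀ : Instance τ U) {I : Instance (segSchema.{v} m r) U} {d : κ}
    (h : E.block d ⊆ I ∧ ∀ d', E.block d' ⊆ I → d' = d) : E.decode D₀ I = E.inst d := by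
  have h' : ∃ d, E.block d ⊆ I ∧ ∀ d', E.block d' ⊆ I → d' = d := ⟨d, h⟩
  rw [decode, dif_pos h', h.2 _ h'.choose_spec.1]

theorem mem_decode (D₀ : Instance τ U) {I : Instance (segSchema.{v} m r) U}
    (hI : ∀ f ∈ I, ∃ d j, segFact (E.seg d j) = f) (R : τ.Rel) (x : Fin (τ.arity R) → U) :
    ((∃ t, segFact t ∈ I ∧ UniqueChain I (t (.inl 0)) ∧
      ∃ l : Fin m, t (.inr (l, none)) = E.code R ∧
        ∀ i : Fin (τ.arity R), t (.inr (l, some (i.castLE (E.arity_le R)))) = x i) ∨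
      ((¬ ∃ t, segFact t ∈ I ∧ UniqueChain I (t (.inl 0))) ∧ (⟨R, x⟩ : Fact τ U) ∈ D₀)) ↔
    (⟨R, x⟩ : Fact τ U) ∈ E.decode D₀ I := by
  by_cases hu : ∃ d, E.block d ⊆ I ∧ ∀ d', E.block d' ⊆ I → d' = d
  · obtain ⟨d, hd⟩ := hu
    have hd' := (E.uniqueChain_iff hI).2 hd
    have h1 : ∃ t, segFact t ∈ I ∧ UniqueChain I (t (.inl 0)) :=
      ⟨_, hd.1 (E.mem_block.2 ⟨0, rfl⟩), hd'⟩
    rw [E.decode_of_unique D₀ hd, E.mem_inst]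
    simp only [h1, not_true, false_and, or_false]
    constructor
    · rintro ⟨t, ht, hc, l, h⟩
      obtain ⟨d', j, h'⟩ := hI _ ht
      obtain rfl := segFact_injective h'
      have := hd.2 d' ((E.uniqueChain_iff hI).1 hc).1
      subst this
      exact ⟨j, l, (E.seg_lists _ j l R x).1 h⟩
    · rintro ⟨j, l, h⟩
      exact ⟨_, hd.1 (E.mem_block.2 ⟨j, rfl⟩), hd', l, (E.seg_lists _ j l R x).2 h⟩
  · have h1 : ¬ ∃ t, segFact t ∈ I ∧ UniqueChain I (t (.inl 0)) := by
      rintro ⟨t, ht, hc⟩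
      obtain ⟨d, j, h'⟩ := hI _ ht
      obtain rfl := segFact_injective h'
      exact hu ⟨d, (E.uniqueChain_iff hI).1 hc⟩
    rw [decode, dif_neg hu]
    constructor
    · rintro (⟨t, ht, hc, -⟩ | ⟨-, h⟩)
      · exact absurd ⟨t, ht, hc⟩ h1
      · exact h
    · exact fun h => Or.inr ⟨h1, h⟩

theorem definable_decode (D₀ : Instance τ U) {G : Set (Instance (segSchema.{v} m r) U)}
    (hG : ∀ I ∈ G, ∀ f ∈ I, ∃ d j, segFact (E.seg d j) = f) (R : τ.Rel) :
    Definable G (τ.arity R) fun I s => (⟨R, fun i => s i⟩ : Fact τ U) ∈ E.decode D₀ I :=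
  ((definable_exists_listed (E.arity_le R) (E.code R)).or
    (definable_exists_uniqueChain.not.and (definable_mem_const D₀ R))).congr
    fun I hI s => E.mem_decode D₀ (hG I hI) R fun i => s i

theorem adom_decode (D₀ : Instance τ U) {I : Instance (segSchema.{v} m r) U} {a : U}
    (ha : a ∈ adom (E.decode D₀ I)) : a ∈ adom I ∨ a ∈ adom D₀ := by
  by_cases hu : ∃ d, E.block d ⊆ I ∧ ∀ d', E.block d' ⊆ I → d' = d
  · left
    obtain ⟨d, hd⟩ := hu
    rw [E.decode_of_unique D₀ hd, mem_adom] at ha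
    obtain ⟨⟨R, x⟩, hf, i, rfl⟩ := ha
    obtain ⟨j, l, h⟩ := (E.mem_inst d _).1 hf
    change x i ∈ adom I
    rw [← ((E.seg_lists d j l R x).2 h).2 i]
    exact mem_adom_of_segFact (hd.1 (E.mem_block.2 ⟨j, rfl⟩)) _
  · right
    rwa [decode, dif_neg hu] at ha

end Segmentation

section Segments

variable {τ : Schema.{v}} {U : Type u}

theorem IsWeightedImage.of_const_mul {m : Instance τ U → ℝ≥0∞} {c : ℝ≥0∞} (hc0 : c ≠ 0)
    (hc : c ≠ ∞) (hm : IsWeightedImage fun D => c * m D) : IsWeightedImage m := by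
  obtain ⟨σ, y, V, C, K, hW, hinf, hdef, hadom, hK0, hK, hmass⟩ := hm
  exact ⟨σ, y, V, C, K * c, hW, hinf, hdef, hadom, mul_ne_zero hK0 hc0, ENNReal.mul_ne_top hK hc,
    fun D => by rw [hmass, mul_assoc]⟩

open Classical in
theorem IsWeightedImage.add_finset {m : Instance τ U → ℝ≥0∞} (hm : IsWeightedImage m)
    (F : Finset (Instance τ U)) {a : Instance τ U → ℝ≥0∞} (ha : ∀ D ∈ F, a D ≠ ∞) :
    IsWeightedImage fun D => m D + if D ∈ F then a D else 0 := by
  induction F using Finset.induction_on with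
  | empty => simpa using hm
  | insert D F hD ih =>
    have h := (ih fun D' hD' => ha D' (Finset.mem_insert_of_mem hD')).add_single D
      (ha D (Finset.mem_insert_self _ _))
    convert h using 2 with D'
    rw [add_assoc]
    congr 1
    by_cases h' : D' = D
    · subst h'
      simp [hD]
    · simp [h']

open Classical in
theorem Segmentation.exists_isWeightedImage {κ : Type w} {m r : ℕ} (E : Segmentation τ U κ m r)
    (D₀ : Instance τ U) {z o : κ → ℝ≥0∞} (hz : ∑' d, ((E.len d + 1 : ℕ) : ℝ≥0∞) * z d ≠ ∞)
    (ho : ∑' d, o d ≤ 2⁻¹)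
    (hzo : ∀ d, z d ^ (E.len d + 1) * (1 + o d) = o d * (1 + z d) ^ (E.len d + 1)) :
    ∃ b ≤ 2, IsWeightedImage fun D =>
      (∑' d, if E.inst d = D then o d else 0) + if D = D₀ then b else 0 := by
  set e : (d : κ) × Fin (E.len d + 1) → Fact (segSchema.{v} m r) U :=
    fun p => segFact (E.seg p.1 p.2) with he
  have hinj : e.Injective := E.segFact_seg_injective
  set y : Fact (segSchema.{v} m r) U → ℝ≥0∞ := Function.extend e (fun p => z p.1) 0 with hy
  have hyseg : ∀ d j, y (segFact (E.seg d j)) = z d := fun d j =>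
    hinj.extend_apply (fun p => z p.1) 0 ⟨d, j⟩
  have hy0 : ∀ f, y f ≠ 0 → ∃ d j, segFact (E.seg d j) = f := by
    intro f hf
    by_contra h
    refine hf (Function.extend_apply' _ _ _ ?_)
    rintro ⟨p, hp⟩
    exact h ⟨p.1, p.2, hp⟩
  have hW : mass y (fun _ => 1) ≠ ∞ := by
    refine mass_one_ne_top ?_
    rw [← hinj.tsum_eq, ENNReal.tsum_sigma']
    · simpa [he, hyseg] using hz
    · intro f hf
      obtain ⟨d, j, h⟩ := hy0 f hf
      exact ⟨⟨d, j⟩, h⟩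
  have hprod : ∀ (d : κ) (F : ℝ≥0∞ → ℝ≥0∞),
      ∏ f ∈ E.block d, F (y f) = F (z d) ^ (E.len d + 1) := by
    intro d F
    rw [Segmentation.block, Finset.prod_image]
    · simp [hyseg]
    · intro j _ j' _ h
      have := hinj (a₁ := ⟨d, j⟩) (a₂ := ⟨d, j'⟩) h
      simpa using this
  have hyo : ∀ d, (∏ f ∈ E.block d, y f) * (1 + o d) = o d * ∏ f ∈ E.block d, (1 + y f) := by
    intro d
    rw [hprod d fun x => x, hprod d fun x => 1 + x, hzo]
  have hdisj : Pairwise fun d d' => Disjoint (E.block d) (E.block d') := by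
    intro d d' hd
    rw [Finset.disjoint_left]
    intro f hf hf'
    obtain ⟨j, rfl⟩ := E.mem_block.1 hf
    obtain ⟨j', h⟩ := E.mem_block.1 hf'
    exact hd (congrArg Sigma.fst (hinj (a₁ := ⟨d', j'⟩) (a₂ := ⟨d, j⟩) h)).symm
  have hotop : ∀ d, o d ≠ ∞ :=
    ENNReal.ne_top_of_tsum_ne_top (ne_top_of_le_ne_top (by simp) ho)
  set N := mass y (fun S => if ∀ d, ¬ E.block d ⊆ S then 1 else 0) with hN
  have hWN : mass y (fun _ => 1) ≤ 2 * N := mass_le_two_mul_no_block hW hyo ho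
  have hN0 : N ≠ 0 := by
    intro h
    rw [h, mul_zero] at hWN
    exact absurd ((apply_empty_le_mass y fun _ => 1).trans hWN) (by simp)
  have hNtop : N ≠ ∞ := mass_ne_top hW fun S => by split_ifs <;> simp
  set M := mass y (fun S =>
    if ∃ d, E.block d ⊆ S ∧ ∀ d', E.block d' ⊆ S → d' = d then 0 else 1) with hM
  refine ⟨M / N, ?_, segSchema m r, y, E.decode D₀, adom D₀, N, hW, ?_, fun R => ?_,
    fun I hI a ha => E.adom_decode D₀ ha, hN0, hNtop, fun D => ?_⟩
  · rw [ENNReal.div_le_iff hN0 hNtop]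
    exact (mass_mono y fun S _ => by split_ifs <;> simp).trans hWN
  · refine Set.infinite_of_injOn_mapsTo (f := fun a => segFact fun _ => a) ?_ ?_ E.infinite_compl
    · intro a _ a' _ h
      exact congrFun (segFact_injective h) (.inl 0)
    · intro a ha
      by_contra h
      obtain ⟨d, j, h'⟩ := hy0 _ h
      exact ha ⟨d, congrFun (segFact_injective h') (.inl 0)⟩
  · exact E.definable_decode D₀ (G := {I | ∀ f ∈ I, y f ≠ 0})
      (fun I hI f hf => hy0 f (hI f hf)) R
  · have h1 : ∀ S, (if E.decode D₀ S = D then (1 : ℝ≥0∞) else 0) =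
        (∑' d, (if E.inst d = D then 1 else 0) *
          if E.block d ⊆ S ∧ ∀ d', E.block d' ⊆ S → d' = d then 1 else 0) +
        (if D = D₀ then 1 else 0) *
          if ∃ d, E.block d ⊆ S ∧ ∀ d', E.block d' ⊆ S → d' = d then 0 else 1 := by
      intro S
      by_cases h : ∃ d, E.block d ⊆ S ∧ ∀ d', E.block d' ⊆ S → d' = d
      · obtain ⟨d, hd⟩ := h
        have h' : ∃ d, E.block d ⊆ S ∧ ∀ d', E.block d' ⊆ S → d' = d := ⟨d, hd⟩
        rw [E.decode_of_unique D₀ hd, if_pos h', mul_zero, add_zero, tsum_eq_single d, if_pos hd,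
          mul_one]
        intro d' hd'
        have h : ¬ (E.block d' ⊆ S ∧ ∀ d'', E.block d'' ⊆ S → d'' = d') := fun h =>
          hd' (hd.2 _ h.1)
        rw [if_neg h, mul_zero]
      · rw [Segmentation.decode, dif_neg h, if_neg h]
        have : ∀ d, ¬ (E.block d ⊆ S ∧ ∀ d', E.block d' ⊆ S → d' = d) := fun d hd => h ⟨d, hd⟩
        simp only [this, if_false, mul_zero, tsum_zero, zero_add, mul_one]
        simp only [eq_comm]
    simp only [h1]
    rw [mass_add, mass_tsum, mass_const, ← hM, mul_add, ← ENNReal.tsum_mul_left]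
    congr 1
    · refine tsum_congr fun d => ?_
      rw [mass_const, mass_unique_block hW hdisj hotop hyo, ← hN]
      split_ifs
      · ring
      · simp
    · split_ifs
      · rw [one_mul, ENNReal.mul_div_cancel hN0 hNtop]
      · simp

/-- The odds of each of `k` independent events of the same probability, where `o` are the odds of
their conjunction. -/
theorem exists_odds {o : ℝ≥0∞} {k : ℕ} (hk : 0 < k) (ho : o ≠ ∞)
    (ho' : o ^ (1 / (k : ℝ)) ≤ 2⁻¹) :
    ∃ z, z ^ k * (1 + o) = o * (1 + z) ^ k ∧ z ≤ 2 * o ^ (1 / (k : ℝ)) := by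
  set q : ℝ≥0∞ := (o / (1 + o)) ^ (1 / (k : ℝ)) with hq
  have hk' : (0 : ℝ) < k := by exact_mod_cast hk
  have h1o : 1 + o ≠ 0 := by simp
  have h1o' : 1 + o ≠ ∞ := by simp [ho]
  have hqo : q ≤ o ^ (1 / (k : ℝ)) := by
    rw [hq]
    gcongr
    exact ENNReal.div_le_of_le_mul (le_mul_of_one_le_right' le_self_add)
  have hq2 : q ≤ 2⁻¹ := hqo.trans ho'
  have hqk : q ^ k = o / (1 + o) := by
    rw [hq, ← ENNReal.rpow_natCast, ← ENNReal.rpow_mul, one_div, inv_mul_cancel₀ hk'.ne',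
      ENNReal.rpow_one]
  have hq1 : q ≤ 1 := hq2.trans (by simp)
  have h2 : (2⁻¹ : ℝ≥0∞) ≤ 1 - q := by
    rw [← ENNReal.one_sub_inv_two]
    exact tsub_le_tsub_left hq2 1
  have h0 : 1 - q ≠ 0 := (lt_of_lt_of_le (by simp) h2).ne'
  have htop : 1 - q ≠ ∞ := ne_top_of_le_ne_top ENNReal.one_ne_top tsub_le_self
  have hz : 1 + q / (1 - q) = (1 - q)⁻¹ := by
    calc 1 + q / (1 - q) = (1 - q) / (1 - q) + q / (1 - q) := by rw [ENNReal.div_self h0 htop]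
      _ = (1 - q)⁻¹ := by rw [← ENNReal.add_div, tsub_add_cancel_of_le hq1, one_div]
  refine ⟨q / (1 - q), ?_, ?_⟩
  · rw [hz, div_eq_mul_inv, mul_pow, hqk, mul_right_comm, ENNReal.div_mul_cancel h1o h1o']
  · rw [mul_comm]
    refine mul_le_mul' hqo ?_
    rw [ENNReal.inv_le_iff_inv_le]
    exact h2

theorem exists_parts {α : Type*} (D : Finset α) (hD : D.Nonempty) {k m : ℕ}
    (h : D.card ≤ k * m) :
    ∃ part : Fin k → Fin m → α, ∀ f, f ∈ D ↔ ∃ j l, part j l = f := by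
  have : Nonempty D := hD.to_subtype
  obtain ⟨e⟩ := Function.Embedding.nonempty_of_card_le (α := D) (β := Fin k × Fin m) (by simpa)
  refine ⟨fun j l => (Function.invFun e (j, l) : D), fun f => ⟨fun hf => ?_, ?_⟩⟩
  · exact ⟨_, _, congrArg Subtype.val (Function.leftInverse_invFun e.injective ⟨f, hf⟩)⟩
  · rintro ⟨j, l, rfl⟩
    exact Subtype.coe_prop _

theorem exists_segmentation [Countable U] [Infinite U] (T : Set (Instance τ U))
    (hT : ∀ D ∈ T, D ≠ ∅) {m : ℕ} (len : T → ℕ)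
    (hlen : ∀ D : T, (D : Instance τ U).card ≤ (len D + 1) * m) :
    ∃ (r : ℕ) (E : Segmentation τ U T m r), (∀ D, E.inst D = D) ∧ E.len = len := by
  have : Countable (Fact τ U) := inferInstance
  have : Countable (Instance τ U) := inferInstance
  obtain ⟨i, hi⟩ := exists_injective_nat (Instance τ U ⊕ ℕ)
  obtain ⟨c, hc⟩ := exists_injective_nat τ.Rel
  have e := Infinite.natEmbedding U
  choose part hpart using fun D : T =>
    exists_parts (D : Instance τ U) (Finset.nonempty_iff_ne_empty.2 (hT D D.2)) (hlen D)
  refine ⟨Finset.univ.sup τ.arity,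
    { inst := fun D => D
      ident := fun D => e (i (.inl D))
      node := e
      code := fun R => e (c R)
      filler := e 0
      len := len
      part := part
      mem_inst := hpart
      ident_injective := fun D D' h => Subtype.ext (Sum.inl_injective (hi (e.injective h)))
      node_injective := e.injective
      code_injective := fun R R' h => hc (e.injective h)
      infinite_compl := ?_
      arity_le := fun R => Finset.le_sup (Finset.mem_univ R) }, fun D => rfl, rfl⟩
  refine (Set.infinite_range_of_injective
    (e.injective.comp (hi.comp Sum.inr_injective))).mono ?_
  rintro _ ⟨n, rfl⟩ ⟨D, h⟩
  exact Sum.inl_ne_inr (hi (e.injective h))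

end Segments

section Main

variable {τ : Schema.{v}} {U : Type u}

open Classical in
/-- The probability of each instance, with value `0` outside the sample space. -/
noncomputable def PDB.weight (𝒟 : PDB τ U) (D : Instance τ U) : ℝ≥0∞ :=
  if hD : D ∈ 𝒟.space then 𝒟.law ⟨D, hD⟩ else 0

theorem PDB.tsum_weight (𝒟 : PDB τ U) : ∑' D, 𝒟.weight D = 1 := by
  rw [← 𝒟.law.tsum_coe, ← tsum_subtype_eq_of_support_subset (s := 𝒟.space)]
  · exact tsum_congr fun D => by simp [PDB.weight]
  · intro D hD
    by_contra h
    simp [PDB.weight, h] at hD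

theorem PDB.tsum_card_mul_weight (𝒟 : PDB τ U) {c : ℕ} (hc : 0 < c) :
    ∑' D : Instance τ U, (D.card : ℝ≥0∞) * 𝒟.weight D ^ ((c : ℝ) / (D.card : ℝ)) =
      ∑' D : {D : 𝒟.space // (D : Instance τ U) ≠ ∅}, ((D.1 : Instance τ U).card : ℝ≥0∞) *
        𝒟.law D.1 ^ ((c : ℝ) / ((D.1 : Instance τ U).card : ℝ)) := by
  have hinj : Function.Injective fun D : {D : 𝒟.space // (D : Instance τ U) ≠ ∅} =>
      (D.1 : Instance τ U) := Subtype.val_injective.comp Subtype.val_injective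
  rw [← hinj.tsum_eq]
  · exact tsum_congr fun D => by simp [PDB.weight]
  · intro D hD
    have h0 : D ≠ ∅ := by rintro rfl; simp at hD
    have hpos : (0 : ℝ) < D.card := by
      exact_mod_cast Finset.card_pos.2 (Finset.nonempty_iff_ne_empty.2 h0)
    have hc' : (0 : ℝ) < c := by exact_mod_cast hc
    have hs : D ∈ 𝒟.space := by
      by_contra h
      refine hD ?_
      simp only [PDB.weight, dif_neg h]
      rw [ENNReal.zero_rpow_of_pos (div_pos hc' hpos), mul_zero]
    exact ⟨⟨⟨D, hs⟩, h0⟩, rfl⟩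

/-- A bound for the total probability of `max 1 (n / c)` independent facts whose conjunction has
odds `l * p`. -/
theorem card_segments_mul_rpow_le {p l : ℝ≥0∞} (hp : p ≤ 1) (hl : 1 ≤ l) {n c k : ℕ}
    (hn : 0 < n) (hk : k = max 1 (n / c)) :
    (k : ℝ≥0∞) * (l * p) ^ (1 / (k : ℝ)) ≤ l * (n * p ^ ((c : ℝ) / (n : ℝ)) + p) := by
  rcases Nat.eq_zero_or_pos (n / c) with h | h
  · have : k = 1 := by simp [hk, h]
    simp only [this, Nat.cast_one, one_mul, div_one, ENNReal.rpow_one]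
    gcongr
    exact le_add_self
  · have hk' : k = n / c := by rw [hk, max_eq_right h]
    have hkpos : (0 : ℝ) < k := by exact_mod_cast hk' ▸ h
    have hk1 : (1 : ℝ) ≤ k := by exact_mod_cast hk' ▸ h
    have hnpos : (0 : ℝ) < n := by exact_mod_cast hn
    have hkc : (k : ℝ) * c ≤ n := by exact_mod_cast hk' ▸ Nat.div_mul_le_self n c
    have hexp : (c : ℝ) / n ≤ 1 / k := by
      rw [div_le_div_iff₀ hnpos hkpos]
      linarith
    have h1 : (l * p) ^ (1 / (k : ℝ)) ≤ l * p ^ ((c : ℝ) / (n : ℝ)) := by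
      rw [ENNReal.mul_rpow_of_nonneg _ _ (by positivity)]
      refine mul_le_mul' ?_ (ENNReal.rpow_le_rpow_of_exponent_ge hp hexp)
      calc l ^ (1 / (k : ℝ)) ≤ l ^ (1 : ℝ) :=
            ENNReal.rpow_le_rpow_of_exponent_le hl ((div_le_one hkpos).2 hk1)
        _ = l := ENNReal.rpow_one l
    have h2 : (k : ℝ≥0∞) ≤ n := by exact_mod_cast hk' ▸ Nat.div_le_self n c
    calc (k : ℝ≥0∞) * (l * p) ^ (1 / (k : ℝ)) ≤ n * (l * p ^ ((c : ℝ) / (n : ℝ))) :=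
          mul_le_mul' h2 h1
      _ = l * (n * p ^ ((c : ℝ) / (n : ℝ))) := by ring
      _ ≤ _ := by gcongr; exact le_self_add

open Classical in
theorem isWeightedImage_of_tsum_lt_top [Countable U] [Infinite U] {p : Instance τ U → ℝ≥0∞}
    (hp : ∑' D, p D = 1) {c : ℕ} (hc : 0 < c)
    (h : ∑' D : Instance τ U, (D.card : ℝ≥0∞) * p D ^ ((c : ℝ) / (D.card : ℝ)) < ∞) :
    IsWeightedImage p := by
  have hp1 : ∀ D, p D ≤ 1 := fun D => hp ▸ ENNReal.le_tsum D
  have hptop : ∀ D, p D ≠ ∞ := fun D => ne_top_of_le_ne_top ENNReal.one_ne_top (hp1 D)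
  obtain ⟨D₀, hD₀⟩ : ∃ D, p D ≠ 0 := by
    by_contra! h0
    simp [h0] at hp
  set l : ℝ≥0∞ := 2 / p D₀ with hl
  have hltop : l ≠ ∞ := ENNReal.div_ne_top (by simp) hD₀
  have hlp : l * p D₀ = 2 := ENNReal.div_mul_cancel hD₀ (hptop _)
  have hl1 : 1 ≤ l := by
    calc (1 : ℝ≥0∞) ≤ 2 := by simp
      _ = l * p D₀ := hlp.symm
      _ ≤ l * 1 := by gcongr; exact hp1 _
      _ = l := mul_one l
  have hl0 : l ≠ 0 := (zero_lt_one.trans_le hl1).ne'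
  set a : Instance τ U → ℝ≥0∞ := fun D => D.card * p D ^ ((c : ℝ) / (D.card : ℝ)) + p D with ha
  have hasum : ∑' D, l * a D ≠ ∞ := by
    rw [ENNReal.tsum_mul_left, ENNReal.tsum_add, hp]
    exact ENNReal.mul_ne_top hltop (ENNReal.add_ne_top.2 ⟨h.ne, ENNReal.one_ne_top⟩)
  obtain ⟨H, hH, hHsum⟩ : ∃ H : Finset (Instance τ U), {D₀, ∅} ⊆ H ∧
      ∑' D : {D // D ∉ H}, l * a D ≤ 2⁻¹ := by
    have h1 := (ENNReal.tendsto_tsum_compl_atTop_zero hasum).eventually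
      (ge_mem_nhds (show (0 : ℝ≥0∞) < 2⁻¹ by simp))
    obtain ⟨H, hH, hH'⟩ := ((Filter.eventually_ge_atTop {D₀, ∅}).and h1).exists
    exact ⟨H, hH, hH'⟩
  have hHD₀ : D₀ ∈ H := hH (by simp)
  set T : Set (Instance τ U) := {D | D ∉ H} with hT
  have hTne : ∀ D ∈ T, D ≠ ∅ := by
    rintro D hD rfl
    exact hD (hH (by simp))
  have hcard : ∀ D : T, 0 < (D : Instance τ U).card := fun D =>
    Finset.card_pos.2 (Finset.nonempty_iff_ne_empty.2 (hTne D D.2))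
  set len : T → ℕ := fun D => (D : Instance τ U).card / c - 1 with hlen
  have hlen' : ∀ D : T, len D + 1 = max 1 ((D : Instance τ U).card / c) := fun D => by
    simp only [hlen]
    omega
  obtain ⟨r, E, hE, hElen⟩ := exists_segmentation T hTne (m := 2 * c) len fun D => by
    have h1 := Nat.lt_mul_div_succ (D : Instance τ U).card hc
    have h2 : (D : Instance τ U).card / c + 1 ≤ 2 * (len D + 1) := by
      simp only [hlen]
      omega
    calc (D : Instance τ U).card ≤ c * ((D : Instance τ U).card / c + 1) := h1.le
      _ ≤ c * (2 * (len D + 1)) := Nat.mul_le_mul_left c h2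
      _ = (len D + 1) * (2 * c) := by ring
  have hodds : ∀ D : T, ∃ z : ℝ≥0∞, z ^ (len D + 1) * (1 + l * p D) =
      l * p D * (1 + z) ^ (len D + 1) ∧ ((len D + 1 : ℕ) : ℝ≥0∞) * z ≤ 2 * (l * a D) := by
    intro D
    have h1 := card_segments_mul_rpow_le (hp1 D) hl1 (hcard D) (hlen' D)
    have h2 : (l * p D) ^ (1 / ((len D + 1 : ℕ) : ℝ)) ≤ 2⁻¹ := by
      refine le_trans ?_ ((h1.trans (ENNReal.le_tsum (f := fun D : T => l * a D) D)).trans hHsum)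
      refine le_mul_of_one_le_left' ?_
      exact_mod_cast Nat.succ_le_succ (Nat.zero_le (len D))
    obtain ⟨z, hz, hz'⟩ := exists_odds (Nat.succ_pos (len D))
      (ENNReal.mul_ne_top hltop (hptop D)) h2
    refine ⟨z, hz, ?_⟩
    calc ((len D + 1 : ℕ) : ℝ≥0∞) * z
        ≤ ((len D + 1 : ℕ) : ℝ≥0∞) * (2 * (l * p D) ^ (1 / ((len D + 1 : ℕ) : ℝ))) := by
          gcongr
      _ = 2 * (((len D + 1 : ℕ) : ℝ≥0∞) * (l * p D) ^ (1 / ((len D + 1 : ℕ) : ℝ))) := by ring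
      _ ≤ 2 * (l * a D) := by gcongr
  choose z hz hz' using hodds
  obtain ⟨b, hb, hw⟩ := E.exists_isWeightedImage D₀ (z := z) (o := fun D => l * p D)
    (by
      rw [hElen]
      refine ne_top_of_le_ne_top ?_ (ENNReal.tsum_le_tsum hz')
      rw [ENNReal.tsum_mul_left]
      exact ENNReal.mul_ne_top (by simp) (ne_top_of_le_ne_top (by simp) hHsum))
    (by
      refine le_trans (ENNReal.tsum_le_tsum fun D => ?_) hHsum
      simp only [ha]
      gcongr
      exact le_add_self)
    (by rwa [hElen])
  refine IsWeightedImage.of_const_mul hl0 hltop ?_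
  have hw' := hw.add_finset H (a := fun D => if D = D₀ then 2 - b else l * p D) fun D _ => by
    split_ifs
    · exact ne_top_of_le_ne_top (by simp) tsub_le_self
    · exact ENNReal.mul_ne_top hltop (hptop D)
  convert hw' using 2 with D
  by_cases hD : D ∈ H
  · have h0 : ∑' d : T, (if E.inst d = D then l * p d else 0) = 0 := by
      refine ENNReal.tsum_eq_zero.2 fun d => if_neg ?_
      rw [hE]
      rintro rfl
      exact d.2 hD
    rw [h0, if_pos hD, zero_add]
    by_cases hDD : D = D₀
    · rw [if_pos hDD, if_pos hDD, add_tsub_cancel_of_le hb, hDD, hlp]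
    · rw [if_neg hDD, if_neg hDD, zero_add]
  · have hDD : D ≠ D₀ := by
      rintro rfl
      exact hD hHD₀
    rw [if_neg hD, if_neg hDD, add_zero, add_zero, tsum_eq_single (⟨D, hD⟩ : T), hE, if_pos rfl]
    intro d hd
    rw [hE, if_neg]
    rintro rfl
    exact hd rfl

end Main

end ProbDB

theorem mainTheorem4 {U : Type*} [Countable U] [Infinite U] {τ : ProbDB.Schema}
    (𝒟 : ProbDB.PDB τ U)
    (h : ∃ c : ℕ, 0 < c ∧
      ∑' D : {D : 𝒟.space // (D : ProbDB.Instance τ U) ≠ ∅},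
        ((D.1 : ProbDB.Instance τ U).card : ℝ≥0∞) *
          𝒟.law D.1 ^ ((c : ℝ) / ((D.1 : ProbDB.Instance τ U).card : ℝ)) < ∞) :
    𝒟.InFOTI := by
  obtain ⟨c, hc, h⟩ := h
  rw [← 𝒟.tsum_card_mul_weight hc] at h
  exact (ProbDB.isWeightedImage_of_tsum_lt_top 𝒟.tsum_weight hc h).inFOTI
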